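/- Throughout, $M_k$ is the space of complex $k\times k$ matrices; $S_\infty^k$ is $M_k$ with the operator norm and its operator space structure $M_k=B(\mathbb C^k)$, and $S_1^k$ is $M_k$ with the trace norm. For $G\in M_n\otimes M_m=M_{nm}$ let $\hat G:S_\infty^n\to S_1^m$ be the linear map $\hat G(x)=(\mathrm{tr}\otimes 1)\big(G(x^T\otimes 1)\big)$. For a linear map $T:X\to Y$ from an operator space $X$ to a normed space $Y$ put $$\pi_{1,cb}(T)=\|1\otimes T:\ell_1\otimes_{\min}X\to\ell_1(Y)\|\in[0,\infty],$$ where $\ell_1$ carries its natural operator space structure, as a subspace of the dual of $\ell_\infty$. A one-way strategy with $c\in\{0,1,2,\dots\}$ bits of communication (from Alice to Bob) consists of positive semidefinite matrices $E_{a,k}\in M_n$ and $F_{b,k}\in M_m$ ($a,b=\pm1$, $k=1,\dots,2^c$) with $\sum_{a,k}E_{a,k}=1$ and $\sum_b F_{b,k}=1$ for every $k$. Put $P(a,b|\rho)=\sum_k\mathrm{tr}\big((E_{a,k}\otimes F_{b,k})\rho\big)$. For a self-adjoint $G\in M_{nm}$ define $$\beta_{owc}(G)=\sup\sum_{a,b=\pm1}ab\,P(a,b|G)=\sup\sum_{k=1}^{2^c}\mathrm{tr}\big(((E_{1,k}-E_{-1,k})\otimes(F_{1,k}-F_{-1,k}))\,G\big),$$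 the supremum being over all $c$ and all such strategies. A quantum XOR game is given by finitely many states $\rho_x\in M_{nm}$ (positive semidefinite, trace one), signs $c_x=\pm1$ and a probability distribution $(p_x)_x$; its operator is $G=\sum_x c_xp_x\rho_x$, and its one-way classical communication bias is the supremum of $2(P_{win}-\tfrac12)$ over all $c$ and all one-way strategies with $c$ bits, where $P_{win}=\sum_x p_x\sum_{ab=c_x}P(a,b|\rho_x)$. **Proposition.** For all $n,m$ and every self-adjoint $G\in M_n\otimes M_m$ (in particular whenever $\|G\|_{S_1^{nm}}\le1$), $$\beta_{owc}(G)\le\pi_{1,cb}(\hat G:S_\infty^n\to S_1^m)\le4\,\beta_{owc}(G).$$ The same two inequalities hold for every quantum XOR game with operator $G$, with its one-way classical communication bias in place of $\beta_{owc}(G)$. -/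

import Mathlib

open scoped ENNReal Kronecker TensorProduct Matrix ComplexOrder

noncomputable section

/-! ### Matrix norms and operator space structures -/

open scoped Matrix.Norms.L2Operator in
/-- The operator norm of a complex matrix, acting between Euclidean spaces. -/
def opNorm {ι κ : Type*} [Fintype ι] [Fintype κ] [DecidableEq κ]
    (A : Matrix ι κ ℂ) : ℝ≥0∞ :=
  ENNReal.ofReal ‖A‖

/-- The trace norm of a complex matrix: the sum of its singular values, which are the square
roots of the eigenvalues of `Aᴴ * A`, counted with multiplicity. -/
def traceNorm {ι : Type*} [Fintype ι] [DecidableEq ι] (A : Matrix ι ι ℂ) : ℝ≥0∞ :=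
  ENNReal.ofReal
    (∑ i, Real.sqrt ((Matrix.isHermitian_conjTranspose_mul_self A).eigenvalues i))

/-- A family of size functions on the spaces `M_N(E)`, one for each `N`; the matrix norms of the
operator spaces below are given in this form. -/
def MatrixNorms (E : Type*) : Type _ :=
  (N : ℕ) → Matrix (Fin N) (Fin N) E → ℝ≥0∞

/-- The operator space `S_∞^n = M_n = B(ℂⁿ)`: a matrix with entries in `M_n` carries its operator
norm as a block matrix. -/
def schattenInfty (n : ℕ) : MatrixNorms (Matrix (Fin n) (Fin n) ℂ) :=
  fun N X => opNorm (Matrix.comp (Fin N) (Fin N) (Fin n) (Fin n) ℂ X)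

/-- The Banach space `ℓ₁` of absolutely summable complex sequences. -/
abbrev EllOne : Type := lp (fun _ : ℕ => ℂ) 1

/-- The natural operator space structure of `ℓ₁`, inherited from the dual of `ℓ_∞`: the norm of
`a ∈ M_N(ℓ₁)` is the completely bounded norm of `ℓ_∞ → M_N`, `f ↦ (∑ₖ a i j k * f k) i j`.
Here `f` runs over the unit ball of `M_q(ℓ_∞)`, that is, over the sequences of contractions
in `M_q`. -/
def ellOne : MatrixNorms EllOne :=
  fun N a =>
    ⨆ (q : ℕ) (f : ℕ → Matrix (Fin q) (Fin q) ℂ) (_ : ∀ k, opNorm (f k) ≤ 1),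
      opNorm (Matrix.of fun (x y : Fin N × Fin q) => ∑' k : ℕ, a x.1 y.1 k * f k x.2 y.2)

/-- The completely bounded norm of a linear map, as an extended non-negative real. -/
def cbNorm {E F : Type*} [AddCommGroup E] [Module ℂ E] [AddCommGroup F] [Module ℂ F]
    (𝓔 : MatrixNorms E) (𝓕 : MatrixNorms F) (φ : E →ₗ[ℂ] F) : ℝ≥0∞ :=
  ⨆ (N : ℕ) (x : Matrix (Fin N) (Fin N) E) (_ : 𝓔 N x ≤ 1), 𝓕 N (x.map φ)

/-- The linear map `φ ⊗ ψ : E ⊗ F → M_p ⊗ M_q = M_{pq}`. -/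
def tensorEval {E F : Type*} [AddCommGroup E] [Module ℂ E] [AddCommGroup F] [Module ℂ F]
    {p q : ℕ} (φ : E →ₗ[ℂ] Matrix (Fin p) (Fin p) ℂ) (ψ : F →ₗ[ℂ] Matrix (Fin q) (Fin q) ℂ) :
    E ⊗[ℂ] F →ₗ[ℂ] Matrix (Fin p × Fin q) (Fin p × Fin q) ℂ :=
  TensorProduct.lift ((Matrix.kroneckerBilinear (R := ℂ) (α := ℂ)).compl₁₂ φ ψ)

/-- The norm of the minimal tensor product `E ⊗_min F`: the supremum of `‖(φ ⊗ ψ)(u)‖` over all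
completely contractive maps `φ : E → M_p`, `ψ : F → M_q`. -/
def minNorm {E F : Type*} [AddCommGroup E] [Module ℂ E] [AddCommGroup F] [Module ℂ F]
    (𝓔 : MatrixNorms E) (𝓕 : MatrixNorms F) (u : E ⊗[ℂ] F) : ℝ≥0∞ :=
  ⨆ (p : ℕ) (q : ℕ)
    (φ : E →ₗ[ℂ] Matrix (Fin p) (Fin p) ℂ) (ψ : F →ₗ[ℂ] Matrix (Fin q) (Fin q) ℂ)
    (_ : cbNorm 𝓔 (schattenInfty p) φ ≤ 1) (_ : cbNorm 𝓕 (schattenInfty q) ψ ≤ 1),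
    opNorm (tensorEval φ ψ u)

/-- The `k`-th coordinate in `Y` of an element of `ℓ₁ ⊗ Y ⊆ ℓ₁(Y)`. -/
def ellOneCoord (Y : Type*) [AddCommGroup Y] [Module ℂ Y] (k : ℕ) :
    EllOne ⊗[ℂ] Y →ₗ[ℂ] Y :=
  (TensorProduct.lid ℂ Y).toLinearMap ∘ₗ
    LinearMap.rTensor Y (lp.evalₗ (𝕜 := ℂ) (fun _ : ℕ => ℂ) 1 k)

/-- The `(1,cb)`-summing norm of `T : X → Y`, for an operator space `X` (matrix norms `𝓧`) and
a normed space `Y` (norm `normY`): the norm of `1 ⊗ T : ℓ₁ ⊗_min X → ℓ₁(Y)`. -/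
def piOneCb {X Y : Type*} [AddCommGroup X] [Module ℂ X] [AddCommGroup Y] [Module ℂ Y]
    (𝓧 : MatrixNorms X) (normY : Y → ℝ≥0∞) (T : X →ₗ[ℂ] Y) : ℝ≥0∞ :=
  ⨆ (u : EllOne ⊗[ℂ] X) (_ : minNorm ellOne 𝓧 u ≤ 1),
    ∑' k : ℕ, normY (ellOneCoord Y k (LinearMap.lTensor EllOne T u))

/-! ### Quantum XOR games -/

/-- Operators on `ℂⁿ ⊗ ℂᵐ`. -/
abbrev BiMatrix (n m : ℕ) : Type := Matrix (Fin n × Fin m) (Fin n × Fin m) ℂ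

/-- The partial trace `tr ⊗ 1` over the first tensor factor. -/
def partialTraceLeft {n m : ℕ} : BiMatrix n m →ₗ[ℂ] Matrix (Fin m) (Fin m) ℂ where
  toFun M := Matrix.of fun b b' => ∑ a, M (a, b) (a, b')
  map_add' M M' := by ext b b'; simp [Finset.sum_add_distrib]
  map_smul' r M := by ext b b'; simp [Finset.mul_sum]

/-- The linear map `Ĝ : M_n → M_m`, `Ĝ(x) = (tr ⊗ 1)(G (xᵀ ⊗ 1))`. -/
def hatMap {n m : ℕ} (G : BiMatrix n m) :
    Matrix (Fin n) (Fin n) ℂ →ₗ[ℂ] Matrix (Fin m) (Fin m) ℂ where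
  toFun x := partialTraceLeft (G * (xᵀ ⊗ₖ (1 : Matrix (Fin m) (Fin m) ℂ)))
  map_add' x y := by
    rw [Matrix.transpose_add, Matrix.add_kronecker, Matrix.mul_add, map_add]
  map_smul' r x := by
    rw [Matrix.transpose_smul, Matrix.smul_kronecker, Matrix.mul_smul, map_smul, RingHom.id_apply]

/-- A strategy in which Alice sends `c` classical bits to Bob. Alice measures with the positive
operators `E a k` (answer `a = ±1`, message `k`); on message `k`, Bob measures with `F · k`. -/
structure OneWayStrategy (n m c : ℕ) where
  E : ℤˣ → Fin (2 ^ c) → Matrix (Fin n) (Fin n) ℂ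
  F : ℤˣ → Fin (2 ^ c) → Matrix (Fin m) (Fin m) ℂ
  E_pos : ∀ a k, (E a k).PosSemidef
  F_pos : ∀ b k, (F b k).PosSemidef
  E_sum : ∑ a, ∑ k, E a k = 1
  F_sum : ∀ k, ∑ b, F b k = 1

/-- `P(a, b | ρ) = ∑ₖ tr((E a k ⊗ F b k) ρ)`, which is real for self-adjoint `ρ`. -/
def OneWayStrategy.prob {n m c : ℕ} (S : OneWayStrategy n m c) (a b : ℤˣ)
    (ρ : BiMatrix n m) : ℝ :=
  (∑ k, ((S.E a k ⊗ₖ S.F b k) * ρ).trace).re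

/-- The one-way classical communication bias of a self-adjoint operator `G`: the supremum, over
all numbers `c` of bits and all strategies, of the correlation
`∑ₐ ∑_b a b P(a, b | G) = ∑ₖ tr(((E 1 k - E (-1) k) ⊗ (F 1 k - F (-1) k)) G)`. -/
def biasOwc {n m : ℕ} (G : BiMatrix n m) : EReal :=
  ⨆ (c : ℕ) (S : OneWayStrategy n m c),
    ((∑ a : ℤˣ, ∑ b : ℤˣ, ((a : ℤ) : ℝ) * ((b : ℤ) : ℝ) * S.prob a b G : ℝ) : EReal)

/-- A bipartite quantum XOR game: the referee picks `x` with probability `p x` and sends the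
state `ρ x`; the players win if the product of their answers is `sign x`. -/
structure QuantumXORGame (n m : ℕ) where
  N : ℕ
  ρ : Fin N → BiMatrix n m
  sign : Fin N → ℤˣ
  p : Fin N → ℝ
  ρ_pos : ∀ x, (ρ x).PosSemidef
  ρ_trace : ∀ x, (ρ x).trace = 1
  p_nonneg : ∀ x, 0 ≤ p x
  p_sum : ∑ x, p x = 1

/-- The operator `∑ₓ cₓ pₓ ρₓ` of a game. -/
def QuantumXORGame.operator {n m : ℕ} (g : QuantumXORGame n m) : BiMatrix n m :=
  ∑ x, ((((g.sign x : ℤ) : ℝ) * g.p x : ℝ) : ℂ) • g.ρ x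

/-- The probability of winning with a given strategy. -/
def QuantumXORGame.winProb {n m c : ℕ} (g : QuantumXORGame n m) (S : OneWayStrategy n m c) : ℝ :=
  ∑ x, g.p x * ∑ a : ℤˣ, ∑ b : ℤˣ, if a * b = g.sign x then S.prob a b (g.ρ x) else 0

/-- The one-way classical communication bias of a game: the supremum of `2 (P_win - 1/2)`. -/
def QuantumXORGame.biasOwc {n m : ℕ} (g : QuantumXORGame n m) : EReal :=
  ⨆ (c : ℕ) (S : OneWayStrategy n m c), ((2 * (g.winProb S - 1 / 2) : ℝ) : EReal)

end

/-! A family `x_k` in `M_n` defines an element `∑ e_k ⊗ x_k` of the unit ball of `ℓ₁ ⊗_min M_n`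
exactly when `∑ f_k ⊗ x_k` is a contraction for all matrix contractions `f_k`. Both inequalities
compare such families with Alice's measurements.

Lower bound: for a strategy, `x_k = (E_{1,k} - E_{-1,k})ᵀ` is such a family, because the `E_{a,k}`
are positive with sum `1`. Pairing `Ĝ(x_k)` with the contraction `F_{1,k} - F_{-1,k}` gives the
`k`-th term of the correlation, which is therefore at most `‖Ĝ(x_k)‖₁`.

Upper bound: the key is `exists_majorants`. The Hermitian parts `h_k` of a contractive family have
majorants `P_k ≥ ±h_k` with `∑ P_k ≤ 2`. For a single weight `s = A Aᴴ > 0`, the choice `P_k = A⁻¹ᴴ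
|Aᴴ h_k A| A⁻¹` satisfies `tr(s ∑ P_k) ≤ tr s`; Hahn–Banach separation turns these weighted bounds
into an operator bound. Then `(P_k ± h_k) / 4`, completed to total `1`, is a measurement for Alice
with differences `h_k / 2`. Bob measures the sign of `Ĝ(h_k)`, so the correlation is `½ ∑
‖Ĝ(h_k)‖₁`. One factor `2` comes from this `½`, the other from splitting `x_k` into real and
imaginary parts. -/

noncomputable section

/-! ### Contractions -/

section Contractions

variable {ι κ : Type*} [Fintype ι] [Fintype κ]

theorem re_star_dotProduct_self (v : ι → ℂ) :
    (star v ⬝ᵥ v).re = ‖WithLp.toLp 2 v‖ ^ 2 := by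
  rw [EuclideanSpace.norm_sq_eq, dotProduct, Complex.re_sum]
  refine Finset.sum_congr rfl fun i _ => ?_
  rw [Pi.star_apply, Complex.star_def, ← Complex.normSq_eq_conj_mul_self, Complex.ofReal_re,
    Complex.normSq_eq_norm_sq]

open scoped Matrix.Norms.L2Operator in
theorem opNorm_le_one_iff [DecidableEq κ] (A : Matrix ι κ ℂ) :
    opNorm A ≤ 1 ↔ ∀ v : κ → ℂ, (star (A *ᵥ v) ⬝ᵥ (A *ᵥ v)).re ≤ (star v ⬝ᵥ v).re := by
  simp only [re_star_dotProduct_self]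
  rw [opNorm, ENNReal.ofReal_le_one]
  constructor
  · intro h v
    have := A.l2_opNorm_mulVec (WithLp.toLp 2 v)
    have h2 : ‖WithLp.toLp 2 (A *ᵥ v)‖ ≤ ‖WithLp.toLp 2 v‖ :=
      this.trans (mul_le_of_le_one_left (norm_nonneg _) h)
    gcongr
  · intro h
    rw [Matrix.l2_opNorm_def]
    refine ContinuousLinearMap.opNorm_le_bound _ zero_le_one fun v => ?_
    rw [one_mul]
    have := h v.ofLp
    exact (pow_le_pow_iff_left₀ (norm_nonneg _) (norm_nonneg _) two_ne_zero).1 this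

/-- This is `|⟨w, A v⟩| ≤ ‖w‖ ‖v‖` after AM-GM. Unlike the product bound, it can be added up over
the terms of a sum of matrices. -/
theorem opNorm_le_one_iff_two_mul_re [DecidableEq κ] (A : Matrix ι κ ℂ) :
    opNorm A ≤ 1 ↔ ∀ (w : ι → ℂ) (v : κ → ℂ),
      2 * (star w ⬝ᵥ (A *ᵥ v)).re ≤ (star w ⬝ᵥ w).re + (star v ⬝ᵥ v).re := by
  rw [opNorm_le_one_iff]
  constructor
  · intro h w v
    have h1 := h v
    have h2 : 0 ≤ (star (w - A *ᵥ v) ⬝ᵥ (w - A *ᵥ v)).re := by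
      rw [re_star_dotProduct_self]; positivity
    have h3 : (star (A *ᵥ v) ⬝ᵥ w).re = (star w ⬝ᵥ (A *ᵥ v)).re := by
      rw [← Complex.conj_re, ← Complex.star_def, Matrix.star_dotProduct, star_star]
    simp only [star_sub, sub_dotProduct, dotProduct_sub, Complex.sub_re, h3] at h2
    linarith
  · intro h v
    linarith [h (A *ᵥ v) v]

theorem opNorm_le_one_iff_posSemidef [DecidableEq κ] (A : Matrix ι κ ℂ) :
    opNorm A ≤ 1 ↔ (1 - Aᴴ * A).PosSemidef := by
  rw [opNorm_le_one_iff]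
  have key : ∀ v : κ → ℂ, star v ⬝ᵥ ((1 - Aᴴ * A) *ᵥ v) =
      star v ⬝ᵥ v - star (A *ᵥ v) ⬝ᵥ (A *ᵥ v) := by
    intro v
    rw [Matrix.sub_mulVec, dotProduct_sub, Matrix.one_mulVec, ← Matrix.mulVec_mulVec,
      Matrix.star_mulVec, ← Matrix.dotProduct_mulVec]
  have hH : (1 - Aᴴ * A).IsHermitian :=
    Matrix.isHermitian_one.sub (Matrix.isHermitian_conjTranspose_mul_self A)
  rw [Matrix.posSemidef_iff_dotProduct_mulVec]
  constructor
  · intro h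
    refine ⟨hH, fun v => ?_⟩
    rw [Complex.nonneg_iff]
    refine ⟨?_, ?_⟩
    · rw [key, Complex.sub_re]; linarith [h v]
    · exact (hH.im_star_dotProduct_mulVec_self v).symm
  · rintro ⟨-, h⟩ v
    have := (Complex.nonneg_iff.1 (h v)).1
    rw [key, Complex.sub_re] at this
    linarith

theorem opNorm_submatrix_equiv_le_one {ι' κ' : Type*} [Fintype ι'] [Fintype κ'] [DecidableEq κ]
    [DecidableEq κ'] {A : Matrix ι κ ℂ} (hA : opNorm A ≤ 1) (e : ι' ≃ ι) (f : κ' ≃ κ) :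
    opNorm (A.submatrix e f) ≤ 1 := by
  rw [opNorm_le_one_iff_posSemidef] at hA ⊢
  have := hA.submatrix f
  rwa [Matrix.submatrix_sub, Pi.sub_apply, Pi.sub_apply, Matrix.submatrix_one_equiv,
    ← Matrix.submatrix_mul_equiv _ _ f e f, ← Matrix.conjTranspose_submatrix] at this

theorem opNorm_transpose_le_one [DecidableEq ι] [DecidableEq κ] {A : Matrix ι κ ℂ}
    (hA : opNorm A ≤ 1) : opNorm Aᵀ ≤ 1 := by
  rw [opNorm_le_one_iff_two_mul_re] at hA ⊢
  intro w v
  have := hA (star v) (star w)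
  rw [star_star, star_star, dotProduct_comm v (star v), dotProduct_comm w] at this
  rw [Matrix.mulVec_transpose, dotProduct_comm, ← Matrix.dotProduct_mulVec]
  linarith

theorem opNorm_smul_le_one [DecidableEq κ] {A : Matrix ι κ ℂ} (hA : opNorm A ≤ 1) {z : ℂ}
    (hz : ‖z‖ = 1) : opNorm (z • A) ≤ 1 := by
  rw [opNorm_le_one_iff_posSemidef] at hA ⊢
  have : star z * z = 1 := by
    rw [Complex.star_def, ← Complex.normSq_eq_conj_mul_self, Complex.normSq_eq_norm_sq, hz]; simp
  rwa [Matrix.conjTranspose_smul, Matrix.smul_mul, Matrix.mul_smul, smul_smul, this, one_smul]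

theorem opNorm_kronecker_one_le_one {A : Matrix ι ι ℂ} [DecidableEq ι] [DecidableEq κ]
    (hA : opNorm A ≤ 1) : opNorm (A ⊗ₖ (1 : Matrix κ κ ℂ)) ≤ 1 := by
  rw [opNorm_le_one_iff_posSemidef] at hA ⊢
  have := hA.kronecker (Matrix.PosSemidef.one (n := κ) (R := ℂ))
  have h : (1 - Aᴴ * A) ⊗ₖ (1 : Matrix κ κ ℂ) =
      1 - (A ⊗ₖ (1 : Matrix κ κ ℂ))ᴴ * (A ⊗ₖ (1 : Matrix κ κ ℂ)) := by
    rw [Matrix.conjTranspose_kronecker, ← Matrix.mul_kronecker_mul, Matrix.conjTranspose_one,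
      Matrix.mul_one, ← Matrix.one_kronecker_one]
    exact map_sub ((Matrix.kroneckerBilinear (R := ℂ) (α := ℂ)).flip (1 : Matrix κ κ ℂ)) _ _
  rwa [h] at this

/-- If `∑ j, E j = 1` with `E j` positive, then `∑ j, g j ⊗ E j` is a contraction whenever all
`g j` are. -/
theorem opNorm_sum_kronecker_le_one {J : Type*} [Fintype J] [DecidableEq ι] [DecidableEq κ]
    {g : J → Matrix ι ι ℂ} {E : J → Matrix κ κ ℂ} (hg : ∀ j, opNorm (g j) ≤ 1)
    (hE : ∀ j, (E j).PosSemidef) (hsum : ∑ j, E j = 1) :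
    opNorm (∑ j, g j ⊗ₖ E j) ≤ 1 := by
  rw [opNorm_le_one_iff_two_mul_re]
  intro w v
  -- As `∑ j, 1 ⊗ E j = 1`, both squared norms split over `j`, and the inequality can be proved for
  -- each `j` separately.
  have hone : ∀ x : ι × κ → ℂ, (star x ⬝ᵥ x).re =
      ∑ j, (star x ⬝ᵥ (((1 : Matrix ι ι ℂ) ⊗ₖ E j) *ᵥ x)).re := by
    intro x
    rw [← Complex.re_sum, ← dotProduct_sum, ← Matrix.sum_mulVec]
    have : ∑ j, (1 : Matrix ι ι ℂ) ⊗ₖ E j = 1 := by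
      rw [← Matrix.one_kronecker_one, ← hsum]
      exact (map_sum (Matrix.kroneckerBilinear (R := ℂ) (α := ℂ) (1 : Matrix ι ι ℂ)) E _).symm
    rw [this, Matrix.one_mulVec]
  rw [hone w, hone v, Matrix.sum_mulVec, dotProduct_sum, Complex.re_sum, Finset.mul_sum,
    ← Finset.sum_add_distrib]
  refine Finset.sum_le_sum fun j _ => ?_
  obtain ⟨B, hB⟩ : ∃ B : Matrix κ κ ℂ, E j = Bᴴ * B := by
    open scoped MatrixOrder in
    obtain ⟨B, hB⟩ := CStarAlgebra.nonneg_iff_eq_star_mul_self.1 (hE j).nonneg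
    exact ⟨B, hB⟩
  -- Applying `1 ⊗ B` to both vectors reduces the `j`-th term to the contraction `g j ⊗ 1`.
  have hfac : ∀ h : Matrix ι ι ℂ, h ⊗ₖ E j =
      ((1 : Matrix ι ι ℂ) ⊗ₖ B)ᴴ * (h ⊗ₖ (1 : Matrix κ κ ℂ)) * ((1 : Matrix ι ι ℂ) ⊗ₖ B) := by
    intro h
    rw [Matrix.conjTranspose_kronecker, ← Matrix.mul_kronecker_mul, ← Matrix.mul_kronecker_mul, hB]
    simp
  have hform : ∀ (h : Matrix ι ι ℂ) (x y : ι × κ → ℂ), star x ⬝ᵥ ((h ⊗ₖ E j) *ᵥ y) =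
      star (((1 : Matrix ι ι ℂ) ⊗ₖ B) *ᵥ x) ⬝ᵥ
        ((h ⊗ₖ (1 : Matrix κ κ ℂ)) *ᵥ (((1 : Matrix ι ι ℂ) ⊗ₖ B) *ᵥ y)) := by
    intro h x y
    rw [hfac, ← Matrix.mulVec_mulVec, ← Matrix.mulVec_mulVec, Matrix.star_mulVec,
      ← Matrix.dotProduct_mulVec]
  rw [hform, hform, hform, Matrix.one_kronecker_one, Matrix.one_mulVec, Matrix.one_mulVec]
  exact (opNorm_le_one_iff_two_mul_re _).1 (opNorm_kronecker_one_le_one (hg j)) _ _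

end Contractions

/-! ### The trace norm -/

section TraceNorm

variable {ι : Type*} [Fintype ι] [DecidableEq ι]

theorem re_star_dotProduct_mulVec_le {A : Matrix ι ι ℂ} (hA : opNorm A ≤ 1) (w v : ι → ℂ) :
    (star w ⬝ᵥ (A *ᵥ v)).re ≤ ‖WithLp.toLp 2 w‖ * ‖WithLp.toLp 2 v‖ := by
  have h1 : star w ⬝ᵥ (A *ᵥ v) = inner ℂ (WithLp.toLp 2 w) (WithLp.toLp 2 (A *ᵥ v)) := by
    rw [EuclideanSpace.inner_toLp_toLp, dotProduct_comm]
  have h2 := (opNorm_le_one_iff A).1 hA v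
  rw [re_star_dotProduct_self, re_star_dotProduct_self,
    pow_le_pow_iff_left₀ (norm_nonneg _) (norm_nonneg _) two_ne_zero] at h2
  rw [h1]
  exact (Complex.re_le_norm _).trans ((norm_inner_le_norm _ _).trans (by gcongr))

theorem Matrix.IsHermitian.norm_eigenvectorBasis {H : Matrix ι ι ℂ} (hH : H.IsHermitian) (i : ι) :
    ‖WithLp.toLp 2 (⇑(hH.eigenvectorBasis i))‖ = 1 :=
  hH.eigenvectorBasis.norm_eq_one i

theorem Matrix.IsHermitian.trace_eq_sum_eigenvectorBasis {H : Matrix ι ι ℂ} (hH : H.IsHermitian)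
    (M : Matrix ι ι ℂ) :
    M.trace = ∑ i, star (⇑(hH.eigenvectorBasis i)) ⬝ᵥ (M *ᵥ ⇑(hH.eigenvectorBasis i)) := by
  have h : M.trace = (star (hH.eigenvectorUnitary : Matrix ι ι ℂ) *
      (M * (hH.eigenvectorUnitary : Matrix ι ι ℂ))).trace := by
    rw [Matrix.trace_mul_comm, Matrix.mul_assoc,
      Unitary.mul_star_self_of_mem hH.eigenvectorUnitary.2, Matrix.mul_one]
  rw [h]
  rfl

/-- A Hermitian matrix is unitarily similar to the diagonal matrix of its eigenvalues. -/
theorem Matrix.IsHermitian.exists_unitary_diagonal {H : Matrix ι ι ℂ} (hH : H.IsHermitian) :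
    ∃ V : Matrix ι ι ℂ, V * Vᴴ = 1 ∧ Vᴴ * V = 1 ∧
      H = V * Matrix.diagonal (fun i => (hH.eigenvalues i : ℂ)) * Vᴴ :=
  ⟨hH.eigenvectorUnitary, Unitary.coe_mul_star_self _, Unitary.coe_star_mul_self _,
    hH.spectral_theorem⟩

/-- In an orthonormal eigenbasis `v_i` of `Aᴴ * A`, the real part of `⟨v_i, U A v_i⟩` is at most `‖A
v_i‖`, the `i`-th singular value. -/
theorem ofReal_re_trace_mul_le_traceNorm {U : Matrix ι ι ℂ} (hU : opNorm U ≤ 1)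
    (A : Matrix ι ι ℂ) : ENNReal.ofReal (U * A).trace.re ≤ traceNorm A := by
  rw [traceNorm]
  refine ENNReal.ofReal_le_ofReal ?_
  set hH := Matrix.isHermitian_conjTranspose_mul_self A
  rw [hH.trace_eq_sum_eigenvectorBasis, Complex.re_sum]
  refine Finset.sum_le_sum fun i _ => ?_
  rw [← Matrix.mulVec_mulVec]
  refine (re_star_dotProduct_mulVec_le hU _ _).trans ?_
  rw [hH.norm_eigenvectorBasis, one_mul, hH.eigenvalues_eq]
  refine Real.le_sqrt_of_sq_le (le_of_eq ?_)
  rw [← re_star_dotProduct_self, Matrix.star_mulVec, ← Matrix.dotProduct_mulVec,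
    Matrix.mulVec_mulVec]
  rfl

open scoped Matrix.Norms.L2Operator in
theorem opNorm_conjTranspose (A : Matrix ι ι ℂ) : opNorm Aᴴ = opNorm A := by
  rw [opNorm, opNorm, Matrix.l2_opNorm_conjTranspose]

/-- Polar decomposition: `U = |A|⁻¹ Aᴴ`, with a pseudo-inverse, is a contraction and `U A = |A|`.
Together with the previous bound this makes the trace norm a maximum of linear functionals. -/
theorem exists_traceNorm_eq (A : Matrix ι ι ℂ) :
    ∃ U : Matrix ι ι ℂ, opNorm U ≤ 1 ∧ traceNorm A = ENNReal.ofReal (U * A).trace.re := by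
  obtain ⟨V, hV, hV', hd⟩ := (Matrix.isHermitian_conjTranspose_mul_self A).exists_unitary_diagonal
  have hnn := Matrix.eigenvalues_conjTranspose_mul_self_nonneg A
  rw [traceNorm]
  set l := (Matrix.isHermitian_conjTranspose_mul_self A).eigenvalues
  -- The convention `0⁻¹ = 0` makes `V * D * Vᴴ` the pseudo-inverse of `|A|`.
  set D : Matrix ι ι ℂ := Matrix.diagonal fun i => (((Real.sqrt (l i))⁻¹ : ℝ) : ℂ) with hD
  have hDH : Dᴴ = D := by
    rw [hD, Matrix.diagonal_conjTranspose]
    congr 1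
    ext i
    simp
  have hLam : Vᴴ * Aᴴ * A * V = Matrix.diagonal fun i => (l i : ℂ) := by
    calc Vᴴ * Aᴴ * A * V = Vᴴ * (Aᴴ * A) * V := by simp only [Matrix.mul_assoc]
      _ = (Vᴴ * V) * (Matrix.diagonal fun i => (l i : ℂ)) * (Vᴴ * V) := by
        rw [hd]; simp only [Matrix.mul_assoc]
      _ = _ := by rw [hV', Matrix.one_mul, Matrix.mul_one]
  refine ⟨V * D * Vᴴ * Aᴴ, ?_, ?_⟩
  · rw [← opNorm_conjTranspose, opNorm_le_one_iff_posSemidef, Matrix.conjTranspose_conjTranspose]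
    have h1 : 1 - V * D * Vᴴ * Aᴴ * (V * D * Vᴴ * Aᴴ)ᴴ =
        V * (1 - D * (Matrix.diagonal fun i => (l i : ℂ)) * D) * Vᴴ := by
      rw [← hLam, Matrix.mul_sub, Matrix.sub_mul, Matrix.mul_one, hV]
      simp only [Matrix.conjTranspose_mul, Matrix.conjTranspose_conjTranspose, hDH,
        Matrix.mul_assoc]
    rw [h1]
    refine Matrix.PosSemidef.mul_mul_conjTranspose_same ?_ V
    rw [hD, Matrix.diagonal_mul_diagonal, Matrix.diagonal_mul_diagonal, ← Matrix.diagonal_one,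
      Matrix.diagonal_sub]
    refine Matrix.PosSemidef.diagonal fun i => ?_
    have h2 : (Real.sqrt (l i))⁻¹ * l i * (Real.sqrt (l i))⁻¹ ≤ 1 := by
      rcases (hnn i).eq_or_lt with h0 | h0
      · have : l i = 0 := h0.symm
        rw [this]; simp
      · have h3 : 0 < Real.sqrt (l i) := Real.sqrt_pos.2 h0
        have h4 := Real.mul_self_sqrt (hnn i)
        change Real.sqrt (l i) * Real.sqrt (l i) = l i at h4
        apply le_of_eq
        field_simp
        nlinarith
    have h5 : (0 : ℝ) ≤ 1 - (Real.sqrt (l i))⁻¹ * l i * (Real.sqrt (l i))⁻¹ := by linarith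
    have h6 := Complex.zero_le_real.2 h5
    push_cast at h6
    simpa using h6
  · congr 1
    have h1 : (V * D * Vᴴ * Aᴴ * A).trace = (D * (Vᴴ * Aᴴ * A * V)).trace := by
      simp only [Matrix.mul_assoc]
      rw [Matrix.trace_mul_comm]
      simp only [Matrix.mul_assoc]
    rw [h1, hLam, hD, Matrix.diagonal_mul_diagonal, Matrix.trace_diagonal, Complex.re_sum]
    refine Finset.sum_congr rfl fun i _ => ?_
    rw [← Complex.ofReal_mul, Complex.ofReal_re]
    rcases (hnn i).eq_or_lt with h0 | h0
    · have : l i = 0 := h0.symm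
      rw [this]; simp
    · have h3 : 0 < Real.sqrt (l i) := Real.sqrt_pos.2 h0
      have h4 := Real.mul_self_sqrt (hnn i)
      change Real.sqrt (l i) * Real.sqrt (l i) = l i at h4
      field_simp
      nlinarith

theorem traceNorm_add_le (A B : Matrix ι ι ℂ) : traceNorm (A + B) ≤ traceNorm A + traceNorm B := by
  obtain ⟨U, hU, h⟩ := exists_traceNorm_eq (A + B)
  rw [h, Matrix.mul_add, Matrix.trace_add, Complex.add_re]
  exact ENNReal.ofReal_add_le.trans
    (add_le_add (ofReal_re_trace_mul_le_traceNorm hU A) (ofReal_re_trace_mul_le_traceNorm hU B))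

theorem traceNorm_smul_le {z : ℂ} (hz : ‖z‖ = 1) (A : Matrix ι ι ℂ) :
    traceNorm (z • A) ≤ traceNorm A := by
  obtain ⟨U, hU, h⟩ := exists_traceNorm_eq (z • A)
  rw [h, Matrix.mul_smul, ← Matrix.smul_mul]
  exact ofReal_re_trace_mul_le_traceNorm (opNorm_smul_le_one hU hz) A

/-- The sign `u` of a Hermitian matrix `z`, for which `u * z = |z|`. -/
theorem Matrix.IsHermitian.exists_sign {z : Matrix ι ι ℂ} (hz : z.IsHermitian) :
    ∃ u : Matrix ι ι ℂ, u.IsHermitian ∧ opNorm u ≤ 1 ∧ (1 + u).PosSemidef ∧ (1 - u).PosSemidef ∧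
      (u * z + z).PosSemidef ∧ (u * z - z).PosSemidef ∧
      traceNorm z ≤ ENNReal.ofReal (u * z).trace.re := by
  obtain ⟨V, hV, hV', hd⟩ := hz.exists_unitary_diagonal
  set l := hz.eigenvalues with hl
  -- The value `1` at the eigenvalue `0` gives `s i * s i = 1` throughout, so `u` is unitary.
  set s : ι → ℝ := fun i => if 0 ≤ l i then 1 else -1 with hs
  have hs2 : ∀ i, s i * s i = 1 := fun i => by simp only [hs]; split_ifs <;> norm_num
  have hsl : ∀ i, s i * l i = |l i| := fun i => by
    simp only [hs]; split_ifs with h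
    · rw [abs_of_nonneg h, one_mul]
    · rw [abs_of_neg (not_le.1 h)]; ring
  have hdiag : ∀ f : ι → ℝ, (∀ i, 0 ≤ f i) →
      (V * Matrix.diagonal (fun i => (f i : ℂ)) * Vᴴ).PosSemidef := fun f hf =>
    (Matrix.PosSemidef.diagonal fun i => Complex.zero_le_real.2 (hf i)).mul_mul_conjTranspose_same V
  have hone : V * Matrix.diagonal (fun _ => ((1 : ℝ) : ℂ)) * Vᴴ = 1 := by
    rw [Complex.ofReal_one, Matrix.diagonal_one, Matrix.mul_one, hV]
  have hadd : ∀ f g : ι → ℝ, V * Matrix.diagonal (fun i => (f i : ℂ)) * Vᴴ +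
      V * Matrix.diagonal (fun i => (g i : ℂ)) * Vᴴ =
      V * Matrix.diagonal (fun i => ((f i + g i : ℝ) : ℂ)) * Vᴴ := fun f g => by
    rw [← Matrix.add_mul, ← Matrix.mul_add, Matrix.diagonal_add]; simp
  have hsub : ∀ f g : ι → ℝ, V * Matrix.diagonal (fun i => (f i : ℂ)) * Vᴴ -
      V * Matrix.diagonal (fun i => (g i : ℂ)) * Vᴴ =
      V * Matrix.diagonal (fun i => ((f i - g i : ℝ) : ℂ)) * Vᴴ := fun f g => by
    rw [← Matrix.sub_mul, ← Matrix.mul_sub, Matrix.diagonal_sub]; simp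
  have hmul : ∀ f g : ι → ℝ, V * Matrix.diagonal (fun i => (f i : ℂ)) * Vᴴ *
      (V * Matrix.diagonal (fun i => (g i : ℂ)) * Vᴴ) =
      V * Matrix.diagonal (fun i => ((f i * g i : ℝ) : ℂ)) * Vᴴ := fun f g => by
    calc _ = V * Matrix.diagonal (fun i => (f i : ℂ)) * (Vᴴ * V) *
        Matrix.diagonal (fun i => (g i : ℂ)) * Vᴴ := by simp only [Matrix.mul_assoc]
      _ = _ := by
        rw [hV', Matrix.mul_one, Matrix.mul_assoc V, Matrix.diagonal_mul_diagonal]; simp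
  set u := V * Matrix.diagonal (fun i => (s i : ℂ)) * Vᴴ with hu
  have huH : u.IsHermitian := by
    rw [Matrix.IsHermitian, hu, Matrix.conjTranspose_mul, Matrix.conjTranspose_mul,
      Matrix.conjTranspose_conjTranspose, Matrix.diagonal_conjTranspose, Matrix.mul_assoc]
    congr 3
    ext i
    simp
  have huz : u * z = V * Matrix.diagonal (fun i => ((|l i| : ℝ) : ℂ)) * Vᴴ := by
    conv_lhs => rw [hd]
    rw [hmul]
    simp only [hsl]
  have hs1 : ∀ i, -1 ≤ s i ∧ s i ≤ 1 := fun i => by simp only [hs]; split_ifs <;> norm_num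
  refine ⟨u, huH, ?_, ?_, ?_, ?_, ?_, ?_⟩
  · rw [opNorm_le_one_iff_posSemidef, huH.eq, hmul]
    simp only [hs2]
    rw [hone, sub_self]
    exact Matrix.PosSemidef.zero
  · rw [← hone, hadd]
    exact hdiag _ fun i => by linarith [(hs1 i).1]
  · rw [← hone, hsub]
    exact hdiag _ fun i => by linarith [(hs1 i).2]
  · rw [huz]
    conv => enter [1, 2]; rw [hd]
    rw [hadd]
    exact hdiag _ fun i => by linarith [neg_abs_le (l i)]
  · rw [huz]
    conv => enter [1, 2]; rw [hd]
    rw [hsub]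
    exact hdiag _ fun i => by linarith [le_abs_self (l i)]
  · obtain ⟨W, hW, h⟩ := exists_traceNorm_eq z
    rw [h]
    refine ENNReal.ofReal_le_ofReal ?_
    have h1 : (u * z).trace.re = ∑ i, |l i| := by
      rw [huz, Matrix.trace_mul_comm, ← Matrix.mul_assoc, hV', Matrix.one_mul,
        Matrix.trace_diagonal, ← Complex.ofReal_sum, Complex.ofReal_re]
    rw [h1, hz.trace_eq_sum_eigenvectorBasis, Complex.re_sum]
    refine Finset.sum_le_sum fun i _ => ?_
    rw [← Matrix.mulVec_mulVec]
    refine (re_star_dotProduct_mulVec_le hW _ _).trans ?_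
    rw [hz.norm_eigenvectorBasis, one_mul, hz.mulVec_eigenvectorBasis, WithLp.toLp_smul,
      norm_smul, hz.norm_eigenvectorBasis, mul_one, Real.norm_eq_abs]

end TraceNorm

/-! ### Positive majorants of a completely contractive family -/

section Majorants

variable {ι K : Type*} [Fintype ι] [DecidableEq ι] [Fintype K]

/-- The Hermitian part of a matrix. -/
def hermPart {ι : Type*} (x : Matrix ι ι ℂ) : Matrix ι ι ℂ := (1 / 2 : ℂ) • (x + xᴴ)

theorem isHermitian_hermPart {ι : Type*} (x : Matrix ι ι ℂ) : (hermPart x).IsHermitian := by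
  rw [hermPart, Matrix.IsHermitian, Matrix.conjTranspose_smul, Matrix.conjTranspose_add,
    Matrix.conjTranspose_conjTranspose, add_comm xᴴ]
  congr 1
  simp

theorem re_trace_conjTranspose {ι : Type*} [Fintype ι] (x : Matrix ι ι ℂ) : (xᴴ).trace.re = x.trace.re := by
  rw [Matrix.trace_conjTranspose, Complex.star_def, Complex.conj_re]

theorem re_trace_hermPart_mul {ι : Type*} [Fintype ι] (x : Matrix ι ι ℂ) {u : Matrix ι ι ℂ} (hu : u.IsHermitian) :
    (hermPart x * u).trace.re = (x * u).trace.re := by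
  have h : (xᴴ * u).trace.re = (x * u).trace.re := by
    rw [← re_trace_conjTranspose (x * u), Matrix.conjTranspose_mul, hu.eq, Matrix.trace_mul_comm]
  rw [hermPart, Matrix.smul_mul, Matrix.trace_smul, Matrix.add_mul, Matrix.trace_add, smul_eq_mul,
    show (1 / 2 : ℂ) = ((1 / 2 : ℝ) : ℂ) by push_cast; rfl, Complex.re_ofReal_mul, Complex.add_re, h]
  ring

theorem Matrix.IsHermitian.one_add_posSemidef {h : Matrix ι ι ℂ} (hh : h.IsHermitian)
    (hc : opNorm h ≤ 1) : (1 + h).PosSemidef := by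
  have hH : (1 + h).IsHermitian := Matrix.isHermitian_one.add hh
  refine Matrix.posSemidef_iff_dotProduct_mulVec.2 ⟨hH, fun v => ?_⟩
  rw [Complex.nonneg_iff]
  refine ⟨?_, (hH.im_star_dotProduct_mulVec_self v).symm⟩
  have := (opNorm_le_one_iff_two_mul_re h).1 hc (-v) v
  rw [star_neg, neg_dotProduct, neg_dotProduct, dotProduct_neg, neg_neg, Complex.neg_re] at this
  rw [Matrix.add_mulVec, Matrix.one_mulVec, dotProduct_add, Complex.add_re]
  linarith

/-- The contraction is tested on the vector `vec A`, where `uᵀ ⊗ x` acts as `A ↦ x A u`. This is why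
test matrices `f k` of the same size as `x k` suffice for the majorants. -/
theorem re_sum_trace_le_of_opNorm_sum_kronecker {x u : K → Matrix ι ι ℂ}
    (hx : opNorm (∑ k, (u k)ᵀ ⊗ₖ x k) ≤ 1) (A : Matrix ι ι ℂ) :
    (∑ k, (Aᴴ * x k * A * u k).trace).re ≤ (A * Aᴴ).trace.re := by
  have := (opNorm_le_one_iff_two_mul_re _).1 hx (Matrix.vec A) (Matrix.vec A)
  rw [Matrix.sum_mulVec, dotProduct_sum, Matrix.star_vec_dotProduct_vec] at this
  simp only [Matrix.kronecker_mulVec_vec, Matrix.star_vec_dotProduct_vec,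
    Matrix.transpose_transpose] at this
  rw [Matrix.trace_mul_comm A]
  simp only [Matrix.mul_assoc] at this ⊢
  linarith

/-- Majorants that are optimal for a given positive definite weight. -/
theorem exists_majorants_of_posDef {x : K → Matrix ι ι ℂ}
    (hx : ∀ f : K → Matrix ι ι ℂ, (∀ k, opNorm (f k) ≤ 1) → opNorm (∑ k, f k ⊗ₖ x k) ≤ 1)
    {s : Matrix ι ι ℂ} (hs : s.PosDef) :
    ∃ P : K → Matrix ι ι ℂ, (∀ k, (P k + hermPart (x k)).PosSemidef) ∧
      (∀ k, (P k - hermPart (x k)).PosSemidef) ∧ (s * ∑ k, P k).trace.re ≤ s.trace.re := by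
  obtain ⟨A, hA⟩ : ∃ A : Matrix ι ι ℂ, s = A * Aᴴ := by
    open scoped MatrixOrder in
    obtain ⟨B, hB⟩ := CStarAlgebra.nonneg_iff_eq_star_mul_self.1 hs.posSemidef.nonneg
    exact ⟨Bᴴ, by rw [Matrix.conjTranspose_conjTranspose]; exact hB⟩
  have hdet : IsUnit A.det := by
    have h1 := (Matrix.isUnit_iff_isUnit_det _).1 hs.isUnit
    rw [hA, Matrix.det_mul] at h1
    exact isUnit_of_mul_isUnit_left h1
  have hAi : A * A⁻¹ = 1 := Matrix.mul_nonsing_inv A hdet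
  have hAi' : A⁻¹ * A = 1 := Matrix.nonsing_inv_mul A hdet
  have hAH : A⁻¹ᴴ * Aᴴ = 1 := by rw [← Matrix.conjTranspose_mul, hAi, Matrix.conjTranspose_one]
  have hAH' : Aᴴ * A⁻¹ᴴ = 1 := by rw [← Matrix.conjTranspose_mul, hAi', Matrix.conjTranspose_one]
  have hz : ∀ k, (Aᴴ * hermPart (x k) * A).IsHermitian := fun k =>
    Matrix.isHermitian_conjTranspose_mul_mul A (isHermitian_hermPart _)
  choose u hu hu1 _ _ hp hm _ using fun k => (hz k).exists_sign
  set z := fun k => Aᴴ * hermPart (x k) * A with hzdef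
  have hy : ∀ k, hermPart (x k) = A⁻¹ᴴ * z k * A⁻¹ := fun k => by
    calc hermPart (x k) = (A⁻¹ᴴ * Aᴴ) * hermPart (x k) * (A * A⁻¹) := by
          rw [hAi, hAH, Matrix.one_mul, Matrix.mul_one]
      _ = _ := by simp only [hzdef, Matrix.mul_assoc]
  -- Since `u k * z k = |z k|` dominates `±z k`, undoing the congruence by `A` gives a majorant of
  -- `±hermPart (x k)`.
  refine ⟨fun k => A⁻¹ᴴ * (u k * z k) * A⁻¹, fun k => ?_, fun k => ?_, ?_⟩
  · rw [hy k, ← Matrix.add_mul, ← Matrix.mul_add]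
    exact (hp k).conjTranspose_mul_mul_same _
  · rw [hy k, ← Matrix.sub_mul, ← Matrix.mul_sub]
    exact (hm k).conjTranspose_mul_mul_same _
  -- The weighted trace of the majorants is `∑ tr |z k|`, the quantity bounded by testing with the
  -- signs `(u k)ᵀ`.
  · have h1 := re_sum_trace_le_of_opNorm_sum_kronecker
      (hx (fun k => (u k)ᵀ) fun k => opNorm_transpose_le_one (hu1 k)) A
    rw [hA]
    refine le_trans (le_of_eq ?_) h1
    rw [Matrix.mul_sum, Matrix.trace_sum, Complex.re_sum, Complex.re_sum]
    refine Finset.sum_congr rfl fun k _ => ?_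
    have h2 : (A * Aᴴ * (A⁻¹ᴴ * (u k * z k) * A⁻¹)).trace = (z k * u k).trace := by
      calc _ = (A * ((Aᴴ * A⁻¹ᴴ) * (u k * z k) * A⁻¹)).trace := by simp only [Matrix.mul_assoc]
        _ = (u k * z k * (A⁻¹ * A)).trace := by
          rw [Matrix.trace_mul_comm, hAH', Matrix.one_mul, Matrix.mul_assoc]
        _ = _ := by rw [hAi', Matrix.mul_one, Matrix.trace_mul_comm]
    have h3 : z k = hermPart (Aᴴ * x k * A) := by
      simp only [hzdef, hermPart, Matrix.conjTranspose_mul, Matrix.conjTranspose_conjTranspose,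
        Matrix.mul_smul, Matrix.smul_mul, Matrix.mul_add, Matrix.add_mul, Matrix.mul_assoc]
    rw [h2, h3, re_trace_hermPart_mul _ (hu k)]

theorem posSemidef_of_add_of_sub {ι : Type*} {P y : Matrix ι ι ℂ} (h1 : (P + y).PosSemidef)
    (h2 : (P - y).PosSemidef) : P.PosSemidef := by
  have h := (h1.add h2).smul (show (0 : ℂ) ≤ (1 / 2 : ℂ) by positivity)
  have h3 : (1 / 2 : ℂ) • (P + y + (P - y)) = P := by
    rw [add_add_sub_cancel, ← two_smul ℂ P, smul_smul]; norm_num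
  rwa [h3] at h

/-- A complex functional on matrices agrees in real part, on Hermitian matrices, with the pairing
with a Hermitian matrix. -/
theorem exists_isHermitian_re_trace_eq (f : Matrix ι ι ℂ →ₗ[ℂ] ℂ) :
    ∃ s : Matrix ι ι ℂ, s.IsHermitian ∧
      ∀ M : Matrix ι ι ℂ, M.IsHermitian → (f M).re = (s * M).trace.re := by
  set t : Matrix ι ι ℂ := Matrix.of fun i j => f (Matrix.single j i 1) with ht
  have hf : ∀ M, f M = (M * t).trace := by
    intro M
    conv_lhs => rw [Matrix.matrix_eq_sum_single M]
    rw [map_sum, Matrix.trace]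
    refine Finset.sum_congr rfl fun i _ => ?_
    rw [map_sum, Matrix.diag_apply, Matrix.mul_apply]
    refine Finset.sum_congr rfl fun j _ => ?_
    rw [ht, Matrix.of_apply, ← smul_eq_mul, ← map_smul, Matrix.smul_single, smul_eq_mul, mul_one]
  refine ⟨hermPart t, isHermitian_hermPart t, fun M hM => ?_⟩
  rw [re_trace_hermPart_mul t hM, hf, Matrix.trace_mul_comm]

open scoped Matrix.Norms.L2Operator Pointwise in
-- A minimax argument: a weight separating `2` from all upper bounds of majorant sums would
-- contradict the bound `tr(s ∑ P_k) ≤ tr s` for that weight. The slack between `1` and `2` leaves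
-- room for an open ball around `S` and a perturbation of the weight.
theorem exists_majorants {x : K → Matrix ι ι ℂ}
    (hx : ∀ f : K → Matrix ι ι ℂ, (∀ k, opNorm (f k) ≤ 1) → opNorm (∑ k, f k ⊗ₖ x k) ≤ 1) :
    ∃ P : K → Matrix ι ι ℂ, (∀ k, (P k + hermPart (x k)).PosSemidef) ∧
      (∀ k, (P k - hermPart (x k)).PosSemidef) ∧ ((2 : ℂ) • 1 - ∑ k, P k).PosSemidef := by
  set S : Set (Matrix ι ι ℂ) := {M | ∃ P : K → Matrix ι ι ℂ,
    (∀ k, (P k + hermPart (x k)).PosSemidef) ∧ (∀ k, (P k - hermPart (x k)).PosSemidef) ∧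
      (M - ∑ k, P k).PosSemidef} with hS
  have hSconv : Convex ℝ S := by
    rintro M ⟨P, hP1, hP2, hP3⟩ N ⟨Q, hQ1, hQ2, hQ3⟩ a b ha hb hab
    refine ⟨fun k => a • P k + b • Q k, fun k => ?_, fun k => ?_, ?_⟩
    · convert! ((hP1 k).smul ha).add ((hQ1 k).smul hb) using 1
      conv_lhs => rw [← one_smul ℝ (hermPart (x k)), ← hab]
      module
    · convert! ((hP2 k).smul ha).add ((hQ2 k).smul hb) using 1
      conv_lhs => rw [← one_smul ℝ (hermPart (x k)), ← hab]
      module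
    · convert! (hP3.smul ha).add (hQ3.smul hb) using 1
      rw [Finset.sum_add_distrib, ← Finset.smul_sum, ← Finset.smul_sum]
      module
  -- If `3/2` is within `1/2` of some `M ∈ S`, then `M ≤ 2`. Adding the ball makes the convex set
  -- open, as the separation theorem requires.
  by_cases hmem : ((3 / 2 : ℂ) • 1 : Matrix ι ι ℂ) ∈ S + Metric.ball 0 (1 / 2)
  · obtain ⟨M, ⟨P, hP1, hP2, hP3⟩, b, hb, hMb⟩ := hmem
    refine ⟨P, hP1, hP2, ?_⟩
    have hPs : (∑ k, P k).IsHermitian := (Matrix.posSemidef_sum _ fun k _ =>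
      posSemidef_of_add_of_sub (hP1 k) (hP2 k)).isHermitian
    have hMH : M.IsHermitian := by simpa using hP3.isHermitian.add hPs
    have hbeq : b = (3 / 2 : ℂ) • 1 - M := by rw [← hMb]; simp
    have hbH : ((2 : ℂ) • b).IsHermitian := by
      rw [hbeq, Matrix.IsHermitian, Matrix.conjTranspose_smul, Matrix.conjTranspose_sub,
        Matrix.conjTranspose_smul, hMH.eq, Matrix.conjTranspose_one]
      simp
    have hbn : opNorm ((2 : ℂ) • b) ≤ 1 := by
      rw [opNorm, ENNReal.ofReal_le_one, norm_smul]
      rw [mem_ball_zero_iff] at hb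
      norm_num
      linarith
    have h1 := hP3.add ((hbH.one_add_posSemidef hbn).smul (show (0 : ℂ) ≤ (1 / 2 : ℂ) by positivity))
    convert! h1 using 1
    rw [hbeq]
    module
  · exfalso
    obtain ⟨f, hf⟩ := RCLike.geometric_hahn_banach_point_open (𝕜 := ℂ)
      (hSconv.add (convex_ball (0 : Matrix ι ι ℂ) (1 / 2))) (Metric.isOpen_ball.add_left) hmem
    have hfS : ∀ M ∈ S, (f ((3 / 2 : ℂ) • 1)).re < (f M).re := fun M hM =>
      hf M ⟨M, hM, 0, Metric.mem_ball_self (by norm_num), add_zero M⟩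
    obtain ⟨s, hsH, hs⟩ := exists_isHermitian_re_trace_eq f.toLinearMap
    change ∀ M : Matrix ι ι ℂ, M.IsHermitian → (f M).re = (s * M).trace.re at hs
    have hone : (f ((3 / 2 : ℂ) • 1)).re = 3 / 2 * s.trace.re := by
      rw [map_smul, smul_eq_mul, show (3 / 2 : ℂ) = ((3 / 2 : ℝ) : ℂ) by push_cast; rfl,
        Complex.re_ofReal_mul, hs 1 Matrix.isHermitian_one, Matrix.mul_one]
    -- `S` is stable under adding positive matrices and `Re f` is bounded below on it, so `Re f`
    -- cannot be negative on a rank-one positive matrix.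
    have hsP : s.PosSemidef := by
      refine Matrix.posSemidef_iff_dotProduct_mulVec.2 ⟨hsH, fun v => ?_⟩
      rw [Complex.nonneg_iff]
      refine ⟨?_, (hsH.im_star_dotProduct_mulVec_self v).symm⟩
      obtain ⟨P, hP1, hP2, -⟩ := exists_majorants_of_posDef hx (Matrix.PosDef.one (n := ι) (R := ℂ))
      have hV := Matrix.posSemidef_vecMulVec_self_star v
      have hfV : (f (Matrix.vecMulVec v (star v))).re = (star v ⬝ᵥ (s *ᵥ v)).re := by
        rw [hs _ hV.isHermitian, Matrix.mul_vecMulVec, Matrix.trace_vecMulVec, dotProduct_comm]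
      rw [← hfV]
      by_contra! hneg
      set r := (f (Matrix.vecMulVec v (star v))).re
      set c := (f ((3 / 2 : ℂ) • 1)).re
      set d := (f (∑ k, P k)).re with hd
      have hlt : ∀ t : ℝ, 0 ≤ t → c < d + t * r := by
        intro t ht
        have := hfS (∑ k, P k + (t : ℂ) • Matrix.vecMulVec v (star v)) ⟨P, hP1, hP2, by
          rw [add_sub_cancel_left]; exact hV.smul (Complex.zero_le_real.2 ht)⟩
        rwa [map_add, map_smul, Complex.add_re, smul_eq_mul, Complex.re_ofReal_mul] at this
      have h0 := hlt 0 le_rfl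
      have h1 := hlt ((c - d) / r) (div_nonneg_of_nonpos (by linarith) hneg.le)
      rw [div_mul_cancel₀ _ hneg.ne] at h1
      linarith
    -- The weight `s` may be singular, so the majorants are taken for `s + δ`. They give `3/2 tr s <
    -- tr s + δ · card ι`, hence `s = 0` as `δ → 0`.
    have hδ : ∀ δ : ℝ, 0 < δ → s.trace.re ≤ 2 * δ * Fintype.card ι := by
      intro δ hδ
      have hpd : (s + (δ : ℂ) • (1 : Matrix ι ι ℂ)).PosDef :=
        Matrix.PosDef.posSemidef_add hsP
          (Matrix.PosDef.one.smul (Complex.zero_lt_real.2 hδ))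
      obtain ⟨P, hP1, hP2, hP3⟩ := exists_majorants_of_posDef hx hpd
      have hPs : (∑ k, P k).PosSemidef := Matrix.posSemidef_sum _ fun k _ =>
        posSemidef_of_add_of_sub (hP1 k) (hP2 k)
      have h1 := hfS (∑ k, P k) ⟨P, hP1, hP2, by rw [sub_self]; exact Matrix.PosSemidef.zero⟩
      rw [hone, hs _ hPs.isHermitian] at h1
      rw [Matrix.add_mul, Matrix.trace_add, Matrix.trace_add, Matrix.smul_mul, Matrix.one_mul,
        Matrix.trace_smul, Matrix.trace_smul, Complex.add_re, Complex.add_re, smul_eq_mul,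
        smul_eq_mul, Complex.re_ofReal_mul, Complex.re_ofReal_mul, Matrix.trace_one,
        Complex.natCast_re] at hP3
      have h2 := mul_nonneg hδ.le (Complex.nonneg_iff.1 hPs.trace_nonneg).1
      linarith
    have htr : s.trace.re ≤ 0 := by
      refine le_of_forall_pos_le_add fun ε hε => ?_
      have hc : (0 : ℝ) < 2 * (Fintype.card ι + 1) := by positivity
      have := hδ (ε / (2 * (Fintype.card ι + 1))) (by positivity)
      refine this.trans ?_
      rw [zero_add, mul_comm 2, mul_assoc, div_mul_eq_mul_div, div_le_iff₀ hc]
      nlinarith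
    have hs0 : s = 0 := by
      rw [← hsP.trace_eq_zero_iff]
      have h1 := Complex.nonneg_iff.1 hsP.trace_nonneg
      exact Complex.ext (le_antisymm htr h1.1) h1.2.symm
    obtain ⟨P, hP1, hP2, -⟩ := exists_majorants_of_posDef hx (Matrix.PosDef.one (n := ι) (R := ℂ))
    have hPs : (∑ k, P k).PosSemidef := Matrix.posSemidef_sum _ fun k _ =>
      posSemidef_of_add_of_sub (hP1 k) (hP2 k)
    have h1 := hfS (∑ k, P k) ⟨P, hP1, hP2, by rw [sub_self]; exact Matrix.PosSemidef.zero⟩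
    rw [hone, hs _ hPs.isHermitian, hs0] at h1
    simp at h1

end Majorants

/-! ### The minimal tensor product of `ℓ₁` and `M_n` -/

section MinTensor

/-- The map `a ↦ ∑ k, a k • f k` from `ℓ₁` to matrices. -/
def ellOneSum {N p : ℕ} (f : Fin N → Matrix (Fin p) (Fin p) ℂ) :
    EllOne →ₗ[ℂ] Matrix (Fin p) (Fin p) ℂ :=
  ∑ k : Fin N, (lp.evalₗ (𝕜 := ℂ) (fun _ : ℕ => ℂ) 1 (k : ℕ)).smulRight (f k)

theorem ellOneSum_apply {N p : ℕ} (f : Fin N → Matrix (Fin p) (Fin p) ℂ) (a : EllOne) :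
    ellOneSum f a = ∑ k : Fin N, a (k : ℕ) • f k := by
  simp only [ellOneSum, LinearMap.sum_apply, LinearMap.smulRight_apply]
  rfl

theorem le_cbNorm {E F : Type*} [AddCommGroup E] [Module ℂ E] [AddCommGroup F] [Module ℂ F]
    {𝓔 : MatrixNorms E} (𝓕 : MatrixNorms F) (φ : E →ₗ[ℂ] F) {N : ℕ}
    {x : Matrix (Fin N) (Fin N) E} (hx : 𝓔 N x ≤ 1) : 𝓕 N (x.map φ) ≤ cbNorm 𝓔 𝓕 φ := by
  unfold cbNorm
  exact le_iSup_of_le N <| le_iSup_of_le x <| le_iSup_of_le hx le_rfl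

/-- Extended by zero, `f` is one of the sequences of contractions over which the norm of `M_N(ℓ₁)`
is a supremum. -/
theorem cbNorm_ellOneSum_le_one {N p : ℕ} {f : Fin N → Matrix (Fin p) (Fin p) ℂ}
    (hf : ∀ k, opNorm (f k) ≤ 1) : cbNorm ellOne (schattenInfty p) (ellOneSum f) ≤ 1 := by
  refine iSup_le fun M => iSup_le fun X => iSup_le fun hX => ?_
  set f' : ℕ → Matrix (Fin p) (Fin p) ℂ := fun k => if h : k < N then f ⟨k, h⟩ else 0 with hf'
  have hf'1 : ∀ k, opNorm (f' k) ≤ 1 := fun k => by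
    simp only [hf']
    split_ifs with h
    · exact hf _
    · rw [opNorm_le_one_iff]
      intro v
      simp [re_star_dotProduct_self]
  refine le_trans ?_ hX
  unfold ellOne
  refine le_iSup_of_le p <| le_iSup_of_le f' <| le_iSup_of_le hf'1 <|
    le_of_eq (congrArg opNorm ?_)
  ext a b
  change ellOneSum f (X a.1 b.1) a.2 b.2 = ∑' k, X a.1 b.1 k * f' k a.2 b.2
  rw [ellOneSum_apply, tsum_eq_sum (s := Finset.range N), ← Fin.sum_univ_eq_sum_range
    (fun k => X a.1 b.1 k * f' k a.2 b.2), Matrix.sum_apply]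
  · refine Finset.sum_congr rfl fun k _ => ?_
    simp [hf']
  · intro k hk
    have : ¬ k < N := by simpa using hk
    simp [hf', this]

theorem cbNorm_id_le_one (n : ℕ) :
    cbNorm (schattenInfty n) (schattenInfty n) LinearMap.id ≤ 1 := by
  refine iSup_le fun M => iSup_le fun X => iSup_le fun hX => ?_
  have : X.map (LinearMap.id : Matrix (Fin n) (Fin n) ℂ →ₗ[ℂ] _) = X := by ext; rfl
  rwa [this]

theorem ellOneCoord_tmul {Y : Type*} [AddCommGroup Y] [Module ℂ Y] (k : ℕ) (a : EllOne) (y : Y) :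
    ellOneCoord Y k (a ⊗ₜ y) = a k • y := by
  rw [ellOneCoord, LinearMap.comp_apply, LinearMap.rTensor_tmul]
  exact TensorProduct.lid_tmul _ _

theorem ellOneCoord_lTensor {X Y : Type*} [AddCommGroup X] [Module ℂ X] [AddCommGroup Y]
    [Module ℂ Y] (T : X →ₗ[ℂ] Y) (k : ℕ) (u : EllOne ⊗[ℂ] X) :
    ellOneCoord Y k (LinearMap.lTensor EllOne T u) = T (ellOneCoord X k u) := by
  induction u with
  | zero => simp
  | tmul a x => rw [LinearMap.lTensor_tmul, ellOneCoord_tmul, ellOneCoord_tmul, map_smul]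
  | add u v hu hv => simp only [map_add, hu, hv]

theorem tensorEval_tmul {E F : Type*} [AddCommGroup E] [Module ℂ E] [AddCommGroup F] [Module ℂ F]
    {p q : ℕ} (φ : E →ₗ[ℂ] Matrix (Fin p) (Fin p) ℂ) (ψ : F →ₗ[ℂ] Matrix (Fin q) (Fin q) ℂ)
    (x : E) (y : F) : tensorEval φ ψ (x ⊗ₜ y) = φ x ⊗ₖ ψ y := by
  rw [tensorEval, TensorProduct.lift.tmul]
  rfl

theorem tensorEval_ellOneSum {N p n : ℕ} (f : Fin N → Matrix (Fin p) (Fin p) ℂ)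
    (u : EllOne ⊗[ℂ] Matrix (Fin n) (Fin n) ℂ) :
    tensorEval (ellOneSum f) LinearMap.id u = ∑ k, f k ⊗ₖ ellOneCoord _ (k : ℕ) u := by
  induction u with
  | zero => simp
  | tmul a x =>
    rw [tensorEval_tmul, ellOneSum_apply, LinearMap.id_apply]
    ext i j
    simp only [ellOneCoord_tmul, Matrix.kroneckerMap_apply, Matrix.sum_apply, Matrix.smul_apply,
      smul_eq_mul, Finset.sum_mul]
    exact Finset.sum_congr rfl fun k _ => by ring
  | add u v hu hv =>
    rw [map_add, hu, hv, ← Finset.sum_add_distrib]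
    simp only [map_add, Matrix.kronecker_add]

theorem opNorm_sum_kronecker_ellOneCoord_le_one {N n : ℕ}
    {u : EllOne ⊗[ℂ] Matrix (Fin n) (Fin n) ℂ} (hu : minNorm ellOne (schattenInfty n) u ≤ 1)
    {f : Fin N → Matrix (Fin n) (Fin n) ℂ} (hf : ∀ k, opNorm (f k) ≤ 1) :
    opNorm (∑ k, f k ⊗ₖ ellOneCoord _ (k : ℕ) u) ≤ 1 := by
  rw [← tensorEval_ellOneSum]
  refine le_trans ?_ hu
  rw [minNorm]
  exact le_iSup_of_le n <| le_iSup_of_le n <| le_iSup_of_le (ellOneSum f) <|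
    le_iSup_of_le LinearMap.id <| le_iSup_of_le (cbNorm_ellOneSum_le_one hf) <|
    le_iSup_of_le (cbNorm_id_le_one n) le_rfl

theorem opNorm_apply_single_le_one {p : ℕ} {φ : EllOne →ₗ[ℂ] Matrix (Fin p) (Fin p) ℂ}
    (hφ : cbNorm ellOne (schattenInfty p) φ ≤ 1) (k : ℕ) :
    opNorm (φ (lp.single 1 k 1)) ≤ 1 := by
  have h1 : ellOne 1 (Matrix.of fun _ _ => lp.single 1 k 1) ≤ 1 := by
    refine iSup_le fun q => iSup_le fun f => iSup_le fun hf => ?_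
    refine le_trans (le_of_eq (congrArg opNorm ?_)) (opNorm_submatrix_equiv_le_one (hf k)
      (Equiv.uniqueProd (Fin q) (Fin 1)) (Equiv.uniqueProd (Fin q) (Fin 1)))
    ext x y
    rw [Matrix.of_apply, tsum_eq_single k]
    · simp [Equiv.uniqueProd]
    · intro j hj
      simp [Pi.single_eq_of_ne hj]
  have h2 : schattenInfty p 1 ((Matrix.of fun _ _ => lp.single 1 k 1).map φ) ≤ 1 :=
    (le_cbNorm _ φ h1).trans hφ
  exact opNorm_submatrix_equiv_le_one h2 (Equiv.uniqueProd (Fin p) (Fin 1)).symm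
    (Equiv.uniqueProd (Fin p) (Fin 1)).symm

/-- If the family `x` is completely contractive then `∑ k, e k ⊗ x k` lies in the unit ball of
`ℓ₁ ⊗_min M_n`. -/
theorem minNorm_sum_single_tmul_le_one {N n : ℕ} {x : Fin N → Matrix (Fin n) (Fin n) ℂ}
    (hx : ∀ (p : ℕ) (f : Fin N → Matrix (Fin p) (Fin p) ℂ), (∀ k, opNorm (f k) ≤ 1) →
      opNorm (∑ k, f k ⊗ₖ x k) ≤ 1) :
    minNorm ellOne (schattenInfty n) (∑ k : Fin N, (lp.single 1 (k : ℕ) 1 : EllOne) ⊗ₜ x k) ≤ 1 := by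
  refine iSup_le fun p => iSup_le fun q => iSup_le fun φ => iSup_le fun ψ => iSup_le fun hφ =>
    iSup_le fun hψ => ?_
  rw [map_sum]
  simp only [tensorEval_tmul]
  set g : Fin N → Matrix (Fin p) (Fin p) ℂ := fun k => φ (lp.single 1 (k : ℕ) 1)
  -- Regrouping `∑ k, g k ⊗ x k` as a `p × p` matrix over `M_n` lets the complete contractivity of
  -- `ψ` act on it entrywise.
  set X : Matrix (Fin p) (Fin p) (Matrix (Fin n) (Fin n) ℂ) :=
    Matrix.of fun i j => ∑ k, g k i j • x k with hX
  have h1 : schattenInfty n p X ≤ 1 := by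
    refine le_trans (le_of_eq ?_) (hx p g fun k => opNorm_apply_single_le_one hφ k)
    rw [schattenInfty]
    congr 1
    ext a b
    change X a.1 b.1 a.2 b.2 = _
    simp [hX, Matrix.sum_apply]
  refine le_trans (le_of_eq ?_) ((le_cbNorm (schattenInfty q) ψ h1).trans hψ)
  rw [schattenInfty]
  congr 1
  ext a b
  change _ = ψ (X a.1 b.1) a.2 b.2
  simp [hX, Matrix.sum_apply, g]

theorem ellOneCoord_sum_single_tmul {N : ℕ} {Y : Type*} [AddCommGroup Y] [Module ℂ Y]
    (x : Fin N → Y) (k : Fin N) :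
    ellOneCoord Y (k : ℕ) (∑ j : Fin N, (lp.single 1 (j : ℕ) 1 : EllOne) ⊗ₜ x j) = x k := by
  rw [map_sum, Finset.sum_eq_single k]
  · simp [ellOneCoord_tmul]
  · intro j _ hj
    rw [ellOneCoord_tmul, lp.single_apply, Pi.single_eq_of_ne, zero_smul]
    exact fun h => hj (Fin.ext h.symm)
  · simp

end MinTensor

/-! ### Correlations of one-way strategies -/

section Strategies

variable {n m c : ℕ}

theorem trace_partialTraceLeft_mul (M : BiMatrix n m) (F : Matrix (Fin m) (Fin m) ℂ) :
    (partialTraceLeft M * F).trace = (M * ((1 : Matrix (Fin n) (Fin n) ℂ) ⊗ₖ F)).trace := by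
  simp only [Matrix.trace, Matrix.diag_apply, Matrix.mul_apply, partialTraceLeft, LinearMap.coe_mk,
    AddHom.coe_mk, Matrix.of_apply, Fintype.sum_prod_type, Matrix.kroneckerMap_apply,
    Finset.sum_mul]
  have h : ∀ (a : Fin n) (b : Fin m), ∑ a', ∑ b', M (a, b) (a', b') *
      ((1 : Matrix (Fin n) (Fin n) ℂ) a' a * F b' b) = ∑ b', M (a, b) (a, b') * F b' b := by
    intro a b
    rw [Finset.sum_eq_single a]
    · simp
    · intro a' _ h
      simp [Matrix.one_apply_ne h]
    · simp
  simp only [h]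
  rw [Finset.sum_comm (s := (Finset.univ : Finset (Fin n)))]
  refine Finset.sum_congr rfl fun b _ => ?_
  rw [Finset.sum_comm]

theorem trace_hatMap_mul (G : BiMatrix n m) (x : Matrix (Fin n) (Fin n) ℂ)
    (F : Matrix (Fin m) (Fin m) ℂ) :
    (hatMap G x * F).trace = ((xᵀ ⊗ₖ F) * G).trace := by
  change (partialTraceLeft (G * (xᵀ ⊗ₖ (1 : Matrix (Fin m) (Fin m) ℂ))) * F).trace = _
  rw [trace_partialTraceLeft_mul, Matrix.mul_assoc, ← Matrix.mul_kronecker_mul, Matrix.mul_one,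
    Matrix.one_mul, Matrix.trace_mul_comm]

/-- The partial trace is cyclic for operators acting only on the factor that is traced out. -/
theorem partialTraceLeft_mul_comm (G : BiMatrix n m) (y : Matrix (Fin n) (Fin n) ℂ) :
    partialTraceLeft (G * (y ⊗ₖ (1 : Matrix (Fin m) (Fin m) ℂ))) =
      partialTraceLeft ((y ⊗ₖ (1 : Matrix (Fin m) (Fin m) ℂ)) * G) := by
  ext b b'
  simp only [Matrix.mul_apply, partialTraceLeft, LinearMap.coe_mk,
    AddHom.coe_mk, Matrix.of_apply, Fintype.sum_prod_type, Matrix.kroneckerMap_apply,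
    Matrix.one_apply, ite_mul, mul_ite, mul_one, zero_mul, mul_zero,
    Finset.sum_ite_eq, Finset.sum_ite_eq', Finset.mem_univ, if_true]
  rw [Finset.sum_comm]
  exact Finset.sum_congr rfl fun _ _ => Finset.sum_congr rfl fun _ _ => mul_comm _ _

theorem isHermitian_hatMap {G : BiMatrix n m} (hG : G.IsHermitian) {x : Matrix (Fin n) (Fin n) ℂ}
    (hx : x.IsHermitian) : (hatMap G x).IsHermitian := by
  change (partialTraceLeft (G * (xᵀ ⊗ₖ (1 : Matrix (Fin m) (Fin m) ℂ)))).IsHermitian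
  have h : ∀ M : BiMatrix n m, (partialTraceLeft M)ᴴ = partialTraceLeft Mᴴ := fun M => by
    ext b b'
    simp [partialTraceLeft]
  rw [Matrix.IsHermitian, h, Matrix.conjTranspose_mul, hG.eq, Matrix.conjTranspose_kronecker,
    Matrix.conjTranspose_one, hx.transpose.eq, partialTraceLeft_mul_comm]

/-- The correlation of the answers `a`, `b` of a strategy on a self-adjoint operator. -/
def OneWayStrategy.correlation (S : OneWayStrategy n m c) (G : BiMatrix n m) : ℝ :=
  ∑ a : ℤˣ, ∑ b : ℤˣ, ((a : ℤ) : ℝ) * ((b : ℤ) : ℝ) * S.prob a b G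

theorem OneWayStrategy.correlation_eq (S : OneWayStrategy n m c) (G : BiMatrix n m) :
    S.correlation G =
      ∑ k, (((S.E 1 k - S.E (-1) k) ⊗ₖ (S.F 1 k - S.F (-1) k)) * G).trace.re := by
  have h : ∀ A B C D, ((A - B : Matrix (Fin n) (Fin n) ℂ) ⊗ₖ (C - D : Matrix (Fin m) (Fin m) ℂ)) =
      A ⊗ₖ C - A ⊗ₖ D - B ⊗ₖ C + B ⊗ₖ D := fun A B C D => by
    ext i j
    simp only [Matrix.kroneckerMap_apply, Matrix.sub_apply, Matrix.add_apply]
    ring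
  simp only [correlation, prob, UnitsInt.univ, Complex.re_sum]
  rw [Finset.sum_pair (by decide), Finset.sum_pair (by decide), Finset.sum_pair (by decide)]
  simp only [h, Matrix.add_mul, Matrix.sub_mul, Matrix.trace_add, Matrix.trace_sub, Complex.add_re,
    Complex.sub_re, Finset.sum_add_distrib, Finset.sum_sub_distrib]
  push_cast
  ring

theorem OneWayStrategy.sum_prob (S : OneWayStrategy n m c) (ρ : BiMatrix n m) :
    ∑ a : ℤˣ, ∑ b : ℤˣ, S.prob a b ρ = ρ.trace.re := by
  have h : ∑ a, ∑ b, ∑ k, S.E a k ⊗ₖ S.F b k = 1 := by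
    have h1 : ∀ a k, ∑ b, S.E a k ⊗ₖ S.F b k = S.E a k ⊗ₖ (1 : Matrix (Fin m) (Fin m) ℂ) :=
      fun a k => by
        rw [← S.F_sum k]
        exact (map_sum (Matrix.kroneckerBilinear (R := ℂ) (α := ℂ) (S.E a k)) _ _).symm
    calc _ = ∑ a, ∑ k, S.E a k ⊗ₖ (1 : Matrix (Fin m) (Fin m) ℂ) := by
          refine Finset.sum_congr rfl fun a _ => ?_
          rw [Finset.sum_comm]
          simp only [h1]
      _ = (∑ a, ∑ k, S.E a k) ⊗ₖ (1 : Matrix (Fin m) (Fin m) ℂ) := by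
          ext i j
          simp only [Matrix.sum_apply, Matrix.kroneckerMap_apply, Finset.sum_mul]
      _ = 1 := by rw [S.E_sum, Matrix.one_kronecker_one]
  simp only [prob, ← Complex.re_sum, ← Matrix.trace_sum, ← Matrix.sum_mul, h, Matrix.one_mul]

/-- For signs, twice the indicator of `ab = c` is `1 + c·ab`, and the outcome probabilities sum to
`tr ρ = 1`. -/
theorem QuantumXORGame.two_mul_winProb_sub (g : QuantumXORGame n m) (S : OneWayStrategy n m c) :
    2 * (g.winProb S - 1 / 2) = S.correlation g.operator := by
  have hlin : S.correlation g.operator =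
      ∑ x, ((g.sign x : ℤ) : ℝ) * g.p x * S.correlation (g.ρ x) := by
    simp only [OneWayStrategy.correlation_eq, operator, Matrix.trace_sum,
      Complex.re_sum, Matrix.mul_smul, Matrix.trace_smul, smul_eq_mul, Complex.re_ofReal_mul,
      Finset.mul_sum]
    exact Finset.sum_comm
  have hx : ∀ x, 2 * ∑ a : ℤˣ, ∑ b : ℤˣ, (if a * b = g.sign x then S.prob a b (g.ρ x) else 0) =
      1 + ((g.sign x : ℤ) : ℝ) * S.correlation (g.ρ x) := by
    intro x
    have h1 := S.sum_prob (g.ρ x)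
    rw [g.ρ_trace, Complex.one_re] at h1
    rw [← h1]
    simp only [OneWayStrategy.correlation, UnitsInt.univ]
    rw [Finset.sum_pair (by decide), Finset.sum_pair (by decide), Finset.sum_pair (by decide),
      Finset.sum_pair (by decide), Finset.sum_pair (by decide), Finset.sum_pair (by decide),
      Finset.sum_pair (by decide), Finset.sum_pair (by decide), Finset.sum_pair (by decide)]
    rcases Int.units_eq_one_or (g.sign x) with h | h <;> rw [h] <;> simp <;> ring
  have hw : 2 * g.winProb S = ∑ x, (g.p x + ((g.sign x : ℤ) : ℝ) * g.p x * S.correlation (g.ρ x)) := by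
    rw [winProb, Finset.mul_sum]
    refine Finset.sum_congr rfl fun x _ => ?_
    rw [mul_left_comm, hx]
    ring
  rw [hlin, mul_sub, hw, Finset.sum_add_distrib, g.p_sum]
  ring

theorem QuantumXORGame.biasOwc_eq (g : QuantumXORGame n m) :
    g.biasOwc = _root_.biasOwc g.operator := by
  rw [QuantumXORGame.biasOwc, _root_.biasOwc]
  simp only [g.two_mul_winProb_sub]
  rfl

theorem QuantumXORGame.isHermitian_operator (g : QuantumXORGame n m) : g.operator.IsHermitian := by
  rw [operator, Matrix.IsHermitian, Matrix.conjTranspose_sum]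
  refine Finset.sum_congr rfl fun x _ => ?_
  rw [Matrix.conjTranspose_smul, (g.ρ_pos x).isHermitian.eq, Complex.star_def, Complex.conj_ofReal]

theorem OneWayStrategy.correlation_le_biasOwc (S : OneWayStrategy n m c) (G : BiMatrix n m) :
    (S.correlation G : EReal) ≤ biasOwc G :=
  le_iSup_of_le c <| le_iSup_of_le S le_rfl

end Strategies

/-! ### The two inequalities -/

section Main

variable {n m c : ℕ}

/-- Polarization: add the form of `1 + h` at `w + v` to the form of `1 - h` at `w - v`. -/
theorem Matrix.IsHermitian.opNorm_le_one {ι : Type*} [Fintype ι] [DecidableEq ι]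
    {h : Matrix ι ι ℂ} (hh : h.IsHermitian) (h1 : (1 + h).PosSemidef) (h2 : (1 - h).PosSemidef) :
    opNorm h ≤ 1 := by
  have key : ∀ w v : ι → ℂ, -(2 * (star w ⬝ᵥ (h *ᵥ v)).re) ≤
      (star w ⬝ᵥ w).re + (star v ⬝ᵥ v).re := by
    intro w v
    have h3 := (Complex.nonneg_iff.1 (h1.dotProduct_mulVec_nonneg (w + v))).1
    have h4 := (Complex.nonneg_iff.1 (h2.dotProduct_mulVec_nonneg (w - v))).1
    have h5 : (star v ⬝ᵥ (h *ᵥ w)).re = (star w ⬝ᵥ (h *ᵥ v)).re := by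
      rw [← Complex.conj_re, ← Complex.star_def, Matrix.star_dotProduct, star_star,
        Matrix.star_mulVec, hh.eq, ← Matrix.dotProduct_mulVec]
    simp only [Matrix.add_mulVec, Matrix.sub_mulVec, Matrix.one_mulVec, Matrix.mulVec_add,
      Matrix.mulVec_sub, star_add, star_sub, add_dotProduct, sub_dotProduct, dotProduct_add,
      dotProduct_sub, Complex.add_re, Complex.sub_re] at h3 h4
    linarith
  rw [opNorm_le_one_iff_two_mul_re]
  intro w v
  have := key (-w) v
  simpa only [star_neg, neg_dotProduct, dotProduct_neg, neg_neg, Complex.neg_re, mul_neg] using this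

/-- The sign of the answer `a` is absorbed into the contraction, leaving a sum over `(a, k)` against
the resolution of identity `(E a k)ᵀ`. -/
theorem OneWayStrategy.opNorm_sum_kronecker_le_one (S : OneWayStrategy n m c) {p : ℕ}
    {f : Fin (2 ^ c) → Matrix (Fin p) (Fin p) ℂ} (hf : ∀ k, opNorm (f k) ≤ 1) :
    opNorm (∑ k, f k ⊗ₖ (S.E 1 k - S.E (-1) k)ᵀ) ≤ 1 := by
  have h := _root_.opNorm_sum_kronecker_le_one (J := ℤˣ × Fin (2 ^ c))
    (g := fun j => ((j.1 : ℤ) : ℂ) • f j.2) (E := fun j => (S.E j.1 j.2)ᵀ) (fun j => ?_)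
    (fun j => (S.E_pos _ _).transpose) ?_
  · convert! h using 2
    rw [Fintype.sum_prod_type, UnitsInt.univ, Finset.sum_pair (by decide),
      ← Finset.sum_add_distrib]
    refine Finset.sum_congr rfl fun k _ => ?_
    ext i j
    simp
    ring
  · refine opNorm_smul_le_one (hf _) ?_
    rcases Int.units_eq_one_or j.1 with h | h <;> rw [h] <;> simp
  · rw [Fintype.sum_prod_type]
    simp only [← Matrix.transpose_sum]
    rw [S.E_sum, Matrix.transpose_one]

theorem OneWayStrategy.opNorm_F_sub_le_one (S : OneWayStrategy n m c) (k : Fin (2 ^ c)) :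
    opNorm (S.F 1 k - S.F (-1) k) ≤ 1 := by
  have hsum : S.F 1 k + S.F (-1) k = 1 := by
    rw [← S.F_sum k, UnitsInt.univ, Finset.sum_pair (by decide)]
  refine Matrix.IsHermitian.opNorm_le_one
    ((S.F_pos 1 k).isHermitian.sub (S.F_pos (-1) k).isHermitian) ?_ ?_
  · convert! (S.F_pos 1 k).add (S.F_pos 1 k) using 1
    rw [← hsum]; abel
  · convert! (S.F_pos (-1) k).add (S.F_pos (-1) k) using 1
    rw [← hsum]; abel

theorem OneWayStrategy.ofReal_correlation_le (S : OneWayStrategy n m c) (G : BiMatrix n m) :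
    ENNReal.ofReal (S.correlation G) ≤ piOneCb (schattenInfty n) traceNorm (hatMap G) := by
  set x : Fin (2 ^ c) → Matrix (Fin n) (Fin n) ℂ := fun k => (S.E 1 k - S.E (-1) k)ᵀ
  have hu := minNorm_sum_single_tmul_le_one (x := x) fun p f hf => S.opNorm_sum_kronecker_le_one hf
  set u := ∑ k : Fin (2 ^ c), (lp.single 1 (k : ℕ) 1 : EllOne) ⊗ₜ[ℂ] x k with hudef
  have h1 : ENNReal.ofReal (S.correlation G) ≤ ∑ k, traceNorm (hatMap G (x k)) := by
    rw [S.correlation_eq]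
    refine (Finset.le_sum_of_subadditive _ ENNReal.ofReal_zero.le (fun _ _ => ENNReal.ofReal_add_le)
      _ _).trans (Finset.sum_le_sum fun k _ => ?_)
    refine le_trans (le_of_eq ?_) (ofReal_re_trace_mul_le_traceNorm (S.opNorm_F_sub_le_one k) _)
    rw [Matrix.trace_mul_comm _ (hatMap G _), trace_hatMap_mul, Matrix.transpose_transpose]
  have h2 : ∑ k, traceNorm (hatMap G (x k)) ≤
      ∑' k : ℕ, traceNorm (ellOneCoord _ k (LinearMap.lTensor EllOne (hatMap G) u)) := by
    refine le_trans (le_of_eq ?_) (ENNReal.sum_le_tsum (Finset.range (2 ^ c)))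
    rw [← Fin.sum_univ_eq_sum_range
      (fun k => traceNorm (ellOneCoord _ k (LinearMap.lTensor EllOne (hatMap G) u)))]
    refine Finset.sum_congr rfl fun k _ => ?_
    rw [ellOneCoord_lTensor, hudef, ellOneCoord_sum_single_tmul]
  refine (h1.trans h2).trans ?_
  rw [piOneCb]
  exact le_iSup_of_le u <| le_iSup_of_le hu le_rfl

/-- A strategy extracted from a completely contractive family. -/
theorem exists_strategy {G : BiMatrix n m} (hG : G.IsHermitian)
    {x : Fin (2 ^ c) → Matrix (Fin n) (Fin n) ℂ}
    (hx : ∀ f : Fin (2 ^ c) → Matrix (Fin n) (Fin n) ℂ, (∀ k, opNorm (f k) ≤ 1) →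
      opNorm (∑ k, f k ⊗ₖ x k) ≤ 1) :
    ∃ S : OneWayStrategy n m c, 0 ≤ S.correlation G ∧
      ∑ k, traceNorm (hatMap G (hermPart (x k))) ≤ 2 * ENNReal.ofReal (S.correlation G) := by
  obtain ⟨P, hP1, hP2, hP3⟩ := exists_majorants hx
  choose u huH hu hu1 hu2 hp hm htr using fun k =>
    (isHermitian_hatMap hG (isHermitian_hermPart (x k))).exists_sign
  -- Half of the defect `R` is shared equally among the `2 * 2 ^ c` outcomes. The shares do not
  -- depend on `a`, so they cancel in `E 1 k - E (-1) k`.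
  set r : ℝ := (4 * (2 ^ c : ℕ))⁻¹ with hr
  have hr0 : (0 : ℂ) ≤ (r : ℂ) := Complex.zero_le_real.2 (by positivity)
  set R : Matrix (Fin n) (Fin n) ℂ := (2 : ℂ) • 1 - ∑ k, P k with hR
  have h4 : (0 : ℂ) ≤ 1 / 4 := by positivity
  have h2 : (0 : ℂ) ≤ 1 / 2 := by positivity
  let S : OneWayStrategy n m c :=
    { E := fun a k => ((1 / 4 : ℂ) • (P k + ((a : ℤ) : ℂ) • hermPart (x k)) + (r : ℂ) • R)ᵀ
      F := fun b k => (1 / 2 : ℂ) • (1 + ((b : ℤ) : ℂ) • u k)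
      E_pos := fun a k => by
        refine (Matrix.PosSemidef.add (Matrix.PosSemidef.smul ?_ h4) (hP3.smul hr0)).transpose
        rcases Int.units_eq_one_or a with h | h <;> rw [h]
        · simpa using hP1 k
        · simpa [← sub_eq_add_neg] using hP2 k
      F_pos := fun b k => by
        refine Matrix.PosSemidef.smul ?_ h2
        rcases Int.units_eq_one_or b with h | h <;> rw [h]
        · simpa using hu1 k
        · simpa [← sub_eq_add_neg] using hu2 k
      E_sum := by
        simp only [← Matrix.transpose_sum]
        rw [← Matrix.transpose_one, UnitsInt.univ, Finset.sum_pair (by decide),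
          ← Finset.sum_add_distrib]
        congr 1
        have : ∀ k, (1 / 4 : ℂ) • (P k + (((1 : ℤˣ) : ℤ) : ℂ) • hermPart (x k)) + (r : ℂ) • R +
            ((1 / 4 : ℂ) • (P k + (((-1 : ℤˣ) : ℤ) : ℂ) • hermPart (x k)) + (r : ℂ) • R) =
            (1 / 2 : ℂ) • P k + (2 * r : ℂ) • R := fun k => by
          push_cast
          module
        simp only [this, Finset.sum_add_distrib, ← Finset.smul_sum, Finset.sum_const,
          Finset.card_univ, Fintype.card_fin]
        have h5 : (2 * r : ℂ) • (2 ^ c) • R = (1 / 2 : ℂ) • R := by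
          rw [← Nat.cast_smul_eq_nsmul ℂ, smul_smul]
          congr 1
          rw [hr]
          push_cast
          field_simp
          norm_num
        rw [h5, hR]
        module
      F_sum := fun k => by
        rw [UnitsInt.univ, Finset.sum_pair (by decide)]
        push_cast
        module }
  have hcorr : S.correlation G =
      ∑ k, 1 / 2 * (u k * hatMap G (hermPart (x k))).trace.re := by
    rw [S.correlation_eq]
    refine Finset.sum_congr rfl fun k _ => ?_
    have hE : S.E 1 k - S.E (-1) k = ((1 / 2 : ℝ) : ℂ) • (hermPart (x k))ᵀ := by
      simp only [S, ← Matrix.transpose_sub, ← Matrix.transpose_smul]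
      congr 1
      push_cast
      module
    have hF : S.F 1 k - S.F (-1) k = u k := by
      simp only [S]
      push_cast
      module
    rw [hE, hF, Matrix.smul_kronecker, Matrix.smul_mul, Matrix.trace_smul, smul_eq_mul,
      Complex.re_ofReal_mul, Matrix.trace_mul_comm (u k), trace_hatMap_mul]
  have hnn : ∀ k, 0 ≤ (u k * hatMap G (hermPart (x k))).trace.re := fun k =>
    (Complex.nonneg_iff.1 (posSemidef_of_add_of_sub (hp k) (hm k)).trace_nonneg).1
  refine ⟨S, ?_, ?_⟩
  · rw [hcorr]
    exact Finset.sum_nonneg fun k _ => mul_nonneg (by norm_num) (hnn k)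
  · have h2 : (2 : ℝ≥0∞) = ENNReal.ofReal 2 := by simp
    rw [h2, ← ENNReal.ofReal_mul (by norm_num), hcorr, ← Finset.mul_sum, ← mul_assoc,
      mul_one_div_cancel two_ne_zero, one_mul, ENNReal.ofReal_sum_of_nonneg fun k _ => hnn k]
    exact Finset.sum_le_sum fun k _ => htr k

/-- Needed so that passing from `EReal` to `ℝ≥0∞` does not change the bias. -/
theorem biasOwc_nonneg {G : BiMatrix n m} (hG : G.IsHermitian) : 0 ≤ biasOwc G := by
  obtain ⟨S, hS, -⟩ := exists_strategy (c := 0) hG (x := fun _ => 0) fun f _ => by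
    rw [opNorm_le_one_iff]
    intro v
    simp [re_star_dotProduct_self]
  exact (EReal.coe_nonneg.2 hS).trans (S.correlation_le_biasOwc G)

theorem sum_traceNorm_hatMap_le {G : BiMatrix n m} (hG : G.IsHermitian)
    {x : Fin (2 ^ c) → Matrix (Fin n) (Fin n) ℂ}
    (hx : ∀ f : Fin (2 ^ c) → Matrix (Fin n) (Fin n) ℂ, (∀ k, opNorm (f k) ≤ 1) →
      opNorm (∑ k, f k ⊗ₖ x k) ≤ 1) :
    ∑ k, traceNorm (hatMap G (x k)) ≤ 4 * (biasOwc G).toENNReal := by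
  have hle : ∀ S : OneWayStrategy n m c,
      ENNReal.ofReal (S.correlation G) ≤ (biasOwc G).toENNReal := fun S => by
    rw [← EReal.real_coe_toENNReal]
    exact EReal.toENNReal_le_toENNReal (S.correlation_le_biasOwc G)
  have hI : ‖-Complex.I‖ = 1 := by simp
  obtain ⟨S, -, hS⟩ := exists_strategy hG hx
  -- The imaginary part of `x k` is the Hermitian part of `-i x k`, and this family is again
  -- contractive since the phase moves onto `f k`.
  obtain ⟨S', -, hS'⟩ := exists_strategy hG (x := fun k => -Complex.I • x k) fun f hf => by
    convert! hx (fun k => -Complex.I • f k) (fun k => opNorm_smul_le_one (hf k) hI) using 2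
    refine Finset.sum_congr rfl fun k _ => ?_
    rw [Matrix.kronecker_smul, Matrix.smul_kronecker]
  have hdec : ∀ k, x k = hermPart (x k) + Complex.I • hermPart (-Complex.I • x k) := fun k => by
    rw [hermPart, hermPart, Matrix.conjTranspose_smul]
    simp only [star_neg, Complex.star_def, Complex.conj_I, neg_neg, smul_smul, smul_add,
      neg_smul, smul_neg]
    rw [show Complex.I * (1 / 2 * Complex.I) = -(1 / 2) by
      linear_combination (1 / 2 : ℂ) * Complex.I_mul_I]
    module
  have htri : ∀ k, traceNorm (hatMap G (x k)) ≤ traceNorm (hatMap G (hermPart (x k))) +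
      traceNorm (hatMap G (hermPart (-Complex.I • x k))) := fun k => by
    conv_lhs => rw [hdec k, map_add, map_smul]
    exact (traceNorm_add_le _ _).trans (add_le_add le_rfl (traceNorm_smul_le (by simp) _))
  calc _ ≤ ∑ k, (traceNorm (hatMap G (hermPart (x k))) +
        traceNorm (hatMap G (hermPart (-Complex.I • x k)))) := Finset.sum_le_sum fun k _ => htri k
    _ ≤ 2 * (biasOwc G).toENNReal + 2 * (biasOwc G).toENNReal := by
      rw [Finset.sum_add_distrib]
      exact add_le_add (hS.trans (by gcongr; exact hle S)) (hS'.trans (by gcongr; exact hle S'))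
    _ = _ := by rw [← add_mul]; norm_num

theorem biasOwc_le_piOneCb (G : BiMatrix n m) :
    biasOwc G ≤ ((piOneCb (schattenInfty n) traceNorm (hatMap G) : ℝ≥0∞) : EReal) := by
  refine iSup_le fun c => iSup_le fun S => ?_
  have h1 : ((S.correlation G : ℝ) : EReal) ≤ ((ENNReal.ofReal (S.correlation G) : ℝ≥0∞) : EReal) := by
    rw [EReal.coe_ennreal_ofReal]
    exact EReal.coe_le_coe_iff.2 (le_max_left _ _)
  exact h1.trans (EReal.coe_ennreal_le_coe_ennreal_iff.2 (S.ofReal_correlation_le G))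

theorem piOneCb_le_four_mul_biasOwc {G : BiMatrix n m} (hG : G.IsHermitian) :
    ((piOneCb (schattenInfty n) traceNorm (hatMap G) : ℝ≥0∞) : EReal) ≤ 4 * biasOwc G := by
  have h : piOneCb (schattenInfty n) traceNorm (hatMap G) ≤ 4 * (biasOwc G).toENNReal := by
    refine iSup_le fun u => iSup_le fun hu => ?_
    refine ENNReal.tsum_le_of_sum_range_le fun N => ?_
    -- The number of messages is a power of two, so the partial sum is lengthened from `N` to `2 ^
    -- N` nonnegative terms.
    calc _ ≤ ∑ k ∈ Finset.range (2 ^ N),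
          traceNorm (ellOneCoord _ k (LinearMap.lTensor EllOne (hatMap G) u)) :=
          Finset.sum_le_sum_of_subset
            (Finset.range_subset_range.2 (Nat.lt_two_pow_self (n := N)).le)
      _ = ∑ k : Fin (2 ^ N), traceNorm (hatMap G (ellOneCoord _ (k : ℕ) u)) := by
          simp only [ellOneCoord_lTensor]
          exact (Fin.sum_univ_eq_sum_range
            (fun k => traceNorm (hatMap G (ellOneCoord _ k u))) _).symm
      _ ≤ _ := sum_traceNorm_hatMap_le hG fun f hf =>
          opNorm_sum_kronecker_ellOneCoord_le_one hu hf
  refine (EReal.coe_ennreal_le_coe_ennreal_iff.2 h).trans (le_of_eq ?_)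
  rw [EReal.coe_ennreal_mul, EReal.coe_toENNReal (biasOwc_nonneg hG)]
  rfl

end Main

end

theorem mainTheorem3 (n m : ℕ) :
    (∀ G : BiMatrix n m, G.IsHermitian →
      biasOwc G ≤ ((piOneCb (schattenInfty n) traceNorm (hatMap G) : ℝ≥0∞) : EReal) ∧
      ((piOneCb (schattenInfty n) traceNorm (hatMap G) : ℝ≥0∞) : EReal) ≤ 4 * biasOwc G) ∧
    (∀ g : QuantumXORGame n m,
      g.biasOwc ≤
        ((piOneCb (schattenInfty n) traceNorm (hatMap g.operator) : ℝ≥0∞) : EReal) ∧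
      ((piOneCb (schattenInfty n) traceNorm (hatMap g.operator) : ℝ≥0∞) : EReal) ≤
        4 * g.biasOwc) := by
  refine ⟨fun G hG => ⟨biasOwc_le_piOneCb G, piOneCb_le_four_mul_biasOwc hG⟩, fun g => ?_⟩
  rw [g.biasOwc_eq]
  exact ⟨biasOwc_le_piOneCb _, piOneCb_le_four_mul_biasOwc g.isHermitian_operator⟩
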